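/- Let $c>0$ and let $W^o$ be a Brownian bridge on $[0,2\pi]$ with variance parameter $c$, that is, a centered Gaussian process $(W^o(t))_{0\le t\le 2\pi}$ on a probability space with almost surely continuous paths and covariance $$\operatorname{Cov}(W^o(s),W^o(t))=c\Big(\min(s,t)-\frac{st}{2\pi}\Big),\qquad s,t\in[0,2\pi]$$ (for $c=1$ this is the law of $B(t)-\frac{t}{2\pi}B(2\pi)$ with $B$ a standard Brownian motion). For $\varphi,\theta\in[0,2\pi]$ put $$W^o_\varphi(\theta)=\begin{cases}W^o(\varphi+\theta)-W^o(\varphi), & \theta\le 2\pi-\varphi,\\ W^o(\varphi+\theta-2\pi)-W^o(\varphi), & \theta> 2\pi-\varphi,\end{cases}\qquad I_\varphi=\int_0^{2\pi}W^o_\varphi(\theta)\,\frac{\sin\theta}{1-\cos\theta}\,d\theta .$$ Then, almost surely, the integrand of $I_\varphi$ is Lebesgue integrable on $[0,2\pi]$ for every $\varphi\in[0,2\pi]$, the function $\varphi\mapsto I_\varphi$ is continuous on $[0,2\pi]$, $\int_0^{2\pi}I_\varphi\,d\varphi=0$, and $$I^*:=\sup_{0\le\varphi\le 2\pi}I_\varphi>0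 .$$ -/

import Mathlib

open MeasureTheory ProbabilityTheory Set
open scoped Real

/-- `W` is a Brownian bridge on `[0, 2π]` with variance parameter `c`: a centered Gaussian process
with covariance `c (min(s,t) - s t / (2π))` and almost surely continuous paths. Only the values
`W t` with `t ∈ [0, 2π]` matter. -/
structure IsBrownianBridge {Ω : Type*} [MeasurableSpace Ω] (W : ℝ → Ω → ℝ) (c : ℝ)
    (P : Measure Ω) : Prop where
  isGaussianProcess : IsGaussianProcess (fun t : Icc (0 : ℝ) (2 * π) => W t) P
  mean_zero : ∀ t ∈ Icc (0 : ℝ) (2 * π), ∫ ω, W t ω ∂P = 0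
  covariance_eq : ∀ s ∈ Icc (0 : ℝ) (2 * π), ∀ t ∈ Icc (0 : ℝ) (2 * π),
    cov[W s, W t; P] = c * (min s t - s * t / (2 * π))
  continuousOn_paths : ∀ᵐ ω ∂P, ContinuousOn (fun t => W t ω) (Icc (0 : ℝ) (2 * π))

/-- The `φ`-shift `w_φ(θ)` of a path `w` on `[0, 2π]`, for `φ, θ ∈ [0, 2π]`. -/
noncomputable def shiftPath (w : ℝ → ℝ) (φ θ : ℝ) : ℝ :=
  if θ ≤ 2 * π - φ then w (φ + θ) - w φ else w (φ + θ - 2 * π) - w φ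

/-- The integrand `w_φ(θ) sin θ / (1 - cos θ)`; its value at `θ ∈ {0, 2π}` is irrelevant. -/
noncomputable def shiftIntegrand (w : ℝ → ℝ) (φ θ : ℝ) : ℝ :=
  shiftPath w φ θ * (Real.sin θ / (1 - Real.cos θ))

/-- `I_φ = ∫₀^{2π} w_φ(θ) sin θ / (1 - cos θ) dθ`. -/
noncomputable def shiftIntegral (w : ℝ → ℝ) (φ : ℝ) : ℝ :=
  ∫ θ in (0 : ℝ)..(2 * π), shiftIntegrand w φ θ

/-- `I^* = sup_{φ ∈ [0, 2π]} I_φ`. -/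
noncomputable def shiftIntegralSup (w : ℝ → ℝ) : ℝ :=
  sSup (shiftIntegral w '' Icc (0 : ℝ) (2 * π))

/-!
The argument is pathwise apart from two almost sure facts about the bridge.

*Hölder paths.* An increment `W t - W s` is centered Gaussian with variance at most `c |t - s|`, so
its fourth moment is at most a constant times `|t - s| ^ 2`. Summing over dyadic increments bounds
all of them at once, almost surely, by a geometric sequence, and chaining makes every path Hölder
continuous of exponent `1 / 8` (`IsBrownianBridge.ae_exists_holderOnWith`). Moreover
`W 0 = W (2 π) = 0` and `W π ≠ 0` almost surely, the latter because `W π` has variance `c π / 2`.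

*Deterministic part.* A path `w` that is Hölder continuous with `w 0 = w (2 π)` is the restriction
of a Hölder continuous `2 π`-periodic function `g`, and
`I_φ = ∫ (g (φ + θ) - g φ) cot (θ / 2) dθ`, which up to normalization is the periodic Hilbert
transform of `g`. Near `0` and `2 π` the integrand is bounded, uniformly in `φ`, by an integrable
power, which gives integrability and, by dominated convergence, continuity in `φ`.

By Fubini's theorem the transform is a Fourier multiplier (`integral_fourier_mul_circleHilbert`):
`∫ e^{-inφ} I_φ dφ = m_n ∫ e^{-inφ} g φ dφ` with `m_n = ∫ (e^{inθ} - 1) cot (θ / 2) dθ`.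
Here `m_0 = 0`, so `I` has mean zero. For `n ≠ 0` the imaginary part of `m_n` is `± 2 π`, so `I ≡ 0`
forces all nonconstant Fourier coefficients of `g` to vanish and `g` to be constant
(`eq_of_circleHilbert_eq_zero`), which is excluded by `W π ≠ 0 = W 0`. Finally, a continuous
function of mean zero that does not vanish identically has a positive supremum.
-/

open Filter Topology
open scoped NNReal ENNReal

/-! ### Chaining: Hölder continuity from dyadic increments -/

theorem HolderOnWith.of_dist_le {X Y : Type*} [PseudoMetricSpace X] [PseudoMetricSpace Y]
    {C α : ℝ≥0} {f : X → Y} {s : Set X}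
    (h : ∀ x ∈ s, ∀ y ∈ s, dist (f x) (f y) ≤ C * dist x y ^ (α : ℝ)) : HolderOnWith C α f s := by
  intro x hx y hy
  have hα : (0 : ℝ) ≤ α := α.2
  have hC : (0 : ℝ) ≤ C := C.2
  rw [edist_dist, edist_dist, ENNReal.ofReal_rpow_of_nonneg dist_nonneg hα,
    ← ENNReal.ofReal_coe_nnreal, ← ENNReal.ofReal_mul hC]
  exact ENNReal.ofReal_le_ofReal (h x hx y hy)

/-- A continuous function whose increments over the dyadic intervals of level `n` are at most
`C * ρ ^ n` is approximated at `s` by its value at the largest dyadic point of level `n` below `s`,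
by telescoping over the finer levels. -/
theorem abs_sub_dyadic_floor_le {f : ℝ → ℝ} (hf : ContinuousOn f (Icc 0 1)) {C ρ : ℝ}
    (hC : 0 ≤ C) (hρ0 : 0 < ρ) (hρ1 : ρ < 1)
    (h : ∀ n k : ℕ, k < 2 ^ n → |f ((k + 1) / 2 ^ n) - f (k / 2 ^ n)| ≤ C * ρ ^ n)
    {s : ℝ} (hs : s ∈ Icc (0 : ℝ) 1) (n : ℕ) :
    |f ((⌊s * 2 ^ n⌋₊ : ℝ) / 2 ^ n) - f s| ≤ C * ρ ^ n / (1 - ρ) := by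
  have hfloor : ∀ m : ℕ, (⌊s * 2 ^ m⌋₊ : ℝ) ≤ s * 2 ^ m := fun m =>
    Nat.floor_le (mul_nonneg hs.1 (by positivity))
  have hmem : ∀ m : ℕ, (⌊s * 2 ^ m⌋₊ : ℝ) / 2 ^ m ∈ Icc (0 : ℝ) 1 := fun m => by
    refine ⟨by positivity, ?_⟩
    rw [div_le_one (by positivity)]
    exact (hfloor m).trans (mul_le_of_le_one_left (by positivity) hs.2)
  have hlim : Tendsto (fun m : ℕ => (⌊s * 2 ^ m⌋₊ : ℝ) / 2 ^ m) atTop (𝓝 s) :=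
    (tendsto_nat_floor_mul_div_atTop hs.1).comp
      (tendsto_pow_atTop_atTop_of_one_lt (one_lt_two : (1 : ℝ) < 2))
  have hflim : Tendsto (fun m : ℕ => f ((⌊s * 2 ^ m⌋₊ : ℝ) / 2 ^ m)) atTop (𝓝 (f s)) :=
    (hf s hs).tendsto.comp
      (tendsto_nhdsWithin_iff.2 ⟨hlim, Eventually.of_forall hmem⟩)
  have hstep : ∀ m : ℕ, dist (f ((⌊s * 2 ^ m⌋₊ : ℝ) / 2 ^ m))
      (f ((⌊s * 2 ^ (m + 1)⌋₊ : ℝ) / 2 ^ (m + 1))) ≤ C * ρ ^ m := by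
    intro m
    have hle : C * ρ ^ (m + 1) ≤ C * ρ ^ m :=
      mul_le_mul_of_nonneg_left (pow_le_pow_of_le_one hρ0.le hρ1.le (Nat.le_succ m)) hC
    have h2 : (2 : ℝ) ^ m ≠ 0 := by positivity
    -- the dyadic approximation either stays put or moves by one interval of level `m + 1`
    have hl : 2 * ⌊s * 2 ^ m⌋₊ ≤ ⌊s * 2 ^ (m + 1)⌋₊ := by
      apply Nat.le_floor
      push_cast
      rw [pow_succ]
      linarith [hfloor m]
    have hu : ⌊s * 2 ^ (m + 1)⌋₊ < 2 * ⌊s * 2 ^ m⌋₊ + 2 := by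
      rw [Nat.floor_lt (mul_nonneg hs.1 (by positivity))]
      push_cast
      rw [pow_succ]
      linarith [Nat.lt_floor_add_one (s * 2 ^ m)]
    have hcases : ⌊s * 2 ^ (m + 1)⌋₊ = 2 * ⌊s * 2 ^ m⌋₊ ∨
        ⌊s * 2 ^ (m + 1)⌋₊ = 2 * ⌊s * 2 ^ m⌋₊ + 1 := by omega
    have hdouble : (⌊s * 2 ^ m⌋₊ : ℝ) / 2 ^ m = ((2 * ⌊s * 2 ^ m⌋₊ : ℕ) : ℝ) / 2 ^ (m + 1) := by
      push_cast
      rw [pow_succ]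
      field_simp
    rw [hdouble]
    rcases hcases with hc | hc
    · rw [hc, dist_self]
      positivity
    · rw [hc, dist_comm, Real.dist_eq, Nat.cast_succ]
      refine (h (m + 1) (2 * ⌊s * 2 ^ m⌋₊) ?_).trans hle
      have h1 : (⌊s * 2 ^ (m + 1)⌋₊ : ℝ) ≤ ((2 ^ (m + 1) : ℕ) : ℝ) := by
        push_cast
        exact (hfloor (m + 1)).trans (mul_le_of_le_one_left (by positivity) hs.2)
      have := Nat.cast_le.1 h1
      omega
  exact dist_le_of_le_geometric_of_tendsto ρ C hρ1 hstep hflim n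

theorem abs_sub_le_of_dyadic_increments {f : ℝ → ℝ} (hf : ContinuousOn f (Icc 0 1)) {C ρ : ℝ}
    (hC : 0 ≤ C) (hρ0 : 0 < ρ) (hρ1 : ρ < 1)
    (h : ∀ n k : ℕ, k < 2 ^ n → |f ((k + 1) / 2 ^ n) - f (k / 2 ^ n)| ≤ C * ρ ^ n)
    {s t : ℝ} (hs : s ∈ Icc (0 : ℝ) 1) (ht : t ∈ Icc (0 : ℝ) 1) (n : ℕ)
    (hst : |s - t| ≤ (1 / 2) ^ n) :
    |f s - f t| ≤ C * (1 + 2 / (1 - ρ)) * ρ ^ n := by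
  wlog hle : s ≤ t generalizing s t
  · rw [abs_sub_comm]
    exact this ht hs (by rwa [abs_sub_comm]) (le_of_not_ge hle)
  have hs' := abs_sub_dyadic_floor_le hf hC hρ0 hρ1 h hs n
  have ht' := abs_sub_dyadic_floor_le hf hC hρ0 hρ1 h ht n
  have hmid : |f ((⌊t * 2 ^ n⌋₊ : ℝ) / 2 ^ n) - f ((⌊s * 2 ^ n⌋₊ : ℝ) / 2 ^ n)| ≤ C * ρ ^ n := by
    -- the dyadic points of level `n` below `s` and `t` are equal or adjacent
    have hdiff : t * 2 ^ n ≤ s * 2 ^ n + 1 := by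
      have h1 : t - s ≤ (1 / 2) ^ n := by
        rw [abs_sub_comm] at hst
        exact (le_abs_self _).trans hst
      have h2 : (t - s) * 2 ^ n ≤ (1 / 2) ^ n * 2 ^ n :=
        mul_le_mul_of_nonneg_right h1 (by positivity)
      rw [← mul_pow] at h2
      norm_num at h2
      linarith
    have hl : ⌊s * 2 ^ n⌋₊ ≤ ⌊t * 2 ^ n⌋₊ :=
      Nat.floor_mono (mul_le_mul_of_nonneg_right hle (by positivity))
    have hu : ⌊t * 2 ^ n⌋₊ ≤ ⌊s * 2 ^ n⌋₊ + 1 := by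
      rw [← Nat.floor_add_one (mul_nonneg hs.1 (by positivity))]
      exact Nat.floor_mono hdiff
    have hcases : ⌊t * 2 ^ n⌋₊ = ⌊s * 2 ^ n⌋₊ ∨ ⌊t * 2 ^ n⌋₊ = ⌊s * 2 ^ n⌋₊ + 1 := by omega
    rcases hcases with hc | hc
    · rw [hc, sub_self, abs_zero]
      positivity
    · rw [hc, Nat.cast_succ]
      refine h n _ ?_
      have h1 : (⌊t * 2 ^ n⌋₊ : ℝ) ≤ ((2 ^ n : ℕ) : ℝ) := by
        push_cast
        exact (Nat.floor_le (mul_nonneg ht.1 (by positivity))).trans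
          (mul_le_of_le_one_left (by positivity) ht.2)
      have := Nat.cast_le.1 h1
      omega
  have hsum : C * (1 + 2 / (1 - ρ)) * ρ ^ n
      = C * ρ ^ n + C * ρ ^ n / (1 - ρ) + C * ρ ^ n / (1 - ρ) := by ring
  rw [hsum]
  rw [abs_le] at *
  constructor <;> linarith [hs'.1, hs'.2, ht'.1, ht'.2, hmid.1, hmid.2]

theorem exists_holderOnWith_of_dyadic_increments {f : ℝ → ℝ} (hf : ContinuousOn f (Icc 0 1))
    {C : ℝ} {α : ℝ≥0} (hα : 0 < α) (hC : 0 ≤ C)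
    (h : ∀ n k : ℕ, k < 2 ^ n →
      |f ((k + 1) / 2 ^ n) - f (k / 2 ^ n)| ≤ C * ((1 / 2 : ℝ) ^ (α : ℝ)) ^ n) :
    ∃ K : ℝ≥0, HolderOnWith K α f (Icc 0 1) := by
  set ρ : ℝ := (1 / 2 : ℝ) ^ (α : ℝ) with hρ
  have hρ0 : 0 < ρ := by positivity
  have hρ1 : ρ < 1 := Real.rpow_lt_one (by norm_num) (by norm_num) (by exact_mod_cast hα)
  set D : ℝ := C * (1 + 2 / (1 - ρ)) with hD
  have hD0 : 0 ≤ D := mul_nonneg hC (by have := sub_pos.2 hρ1; positivity)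
  refine ⟨(D / ρ).toNNReal, HolderOnWith.of_dist_le fun s hs t ht => ?_⟩
  rcases eq_or_ne s t with rfl | hne
  · simpa using by positivity
  have hpos : 0 < |s - t| := abs_pos.2 (sub_ne_zero.2 hne)
  have hle1 : |s - t| ≤ 1 := by
    rw [abs_le]
    constructor <;> linarith [hs.1, hs.2, ht.1, ht.2]
  obtain ⟨n, hn, hn'⟩ := exists_nat_pow_near_of_lt_one hpos hle1
    (by norm_num : (0 : ℝ) < 1 / 2) (by norm_num : (1 / 2 : ℝ) < 1)
  have hbound : |f s - f t| ≤ D / ρ * |s - t| ^ (α : ℝ) := by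
    have h1 := abs_sub_le_of_dyadic_increments hf hC hρ0 hρ1 h hs ht n hn'
    have h2 : ρ ^ (n + 1) ≤ |s - t| ^ (α : ℝ) := by
      rw [hρ, ← Real.rpow_mul_natCast (by norm_num), mul_comm, Real.rpow_natCast_mul (by norm_num)]
      exact Real.rpow_le_rpow (by positivity) hn.le α.2
    calc |f s - f t| ≤ D * ρ ^ n := h1
      _ = D / ρ * ρ ^ (n + 1) := by
        rw [pow_succ]
        field_simp
      _ ≤ D / ρ * |s - t| ^ (α : ℝ) := mul_le_mul_of_nonneg_left h2 (by positivity)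
  rw [Real.coe_toNNReal _ (by positivity)]
  exact hbound

/-! ### Almost sure Hölder continuity from fourth moments -/

/-- By scaling, the fourth moment of a centered Gaussian is proportional to the squared variance. -/
theorem lintegral_enorm_pow_four_gaussianReal (v : ℝ≥0) :
    ∫⁻ x, ‖x‖ₑ ^ 4 ∂gaussianReal 0 v
      = (v : ℝ≥0∞) ^ 2 * ∫⁻ x, ‖x‖ₑ ^ 4 ∂gaussianReal 0 1 := by
  have hmap : (gaussianReal 0 1).map (fun x => √(v : ℝ) * x) = gaussianReal 0 v := by
    rw [gaussianReal_map_const_mul]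
    congr 1
    · simp
    · ext
      simp
  have hsq : ‖√(v : ℝ)‖ₑ ^ 2 = v := by
    have hv : (0 : ℝ) ≤ v := v.2
    rw [← enorm_pow, Real.sq_sqrt hv, Real.enorm_eq_ofReal hv, ENNReal.ofReal_coe_nnreal]
  rw [← hmap, lintegral_map (by fun_prop) (by fun_prop)]
  simp_rw [enorm_mul, mul_pow]
  rw [lintegral_const_mul _ (by fun_prop), ← hsq, ← pow_mul]

theorem lintegral_enorm_pow_four_gaussianReal_ne_top :
    ∫⁻ x, ‖x‖ₑ ^ 4 ∂gaussianReal 0 1 ≠ ∞ := by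
  have h := (memLp_id_gaussianReal (μ := 0) (v := 1) 4).eLpNorm_lt_top
  have h4 := (eLpNorm_lt_top_iff_lintegral_rpow_enorm_lt_top (by norm_num) (by norm_num)).1 h
  simpa using h4.ne

/-- If the weighted fourth moments are summable, the sum of the weighted fourth powers is almost
surely finite, and it bounds each of its terms. -/
theorem ae_exists_abs_le_of_tsum_lintegral {Ω ι : Type*} [Countable ι] [MeasurableSpace Ω]
    {P : Measure Ω} {X : ι → Ω → ℝ} (hX : ∀ i, AEMeasurable (X i) P) {a : ι → ℝ≥0}
    (hsum : ∑' i, (a i : ℝ≥0∞) * ∫⁻ ω, ‖X i ω‖ₑ ^ 4 ∂P ≠ ∞) :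
    ∀ᵐ ω ∂P, ∃ C : ℝ, 0 ≤ C ∧ ∀ i, a i * |X i ω| ^ 4 ≤ C := by
  have hmeas : ∀ i, AEMeasurable (fun ω => (a i : ℝ≥0∞) * ‖X i ω‖ₑ ^ 4) P := fun i =>
    ((hX i).enorm.pow_const 4).const_mul _
  have hfin : ∫⁻ ω, ∑' i, (a i : ℝ≥0∞) * ‖X i ω‖ₑ ^ 4 ∂P ≠ ∞ := by
    rw [lintegral_tsum hmeas]
    convert hsum using 4 with i
    exact lintegral_const_mul'' _ ((hX i).enorm.pow_const 4)
  filter_upwards [ae_lt_top' (AEMeasurable.tsum hmeas) hfin] with ω hω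
  refine ⟨(∑' i, (a i : ℝ≥0∞) * ‖X i ω‖ₑ ^ 4).toReal, ENNReal.toReal_nonneg, fun i => ?_⟩
  have h1 := ENNReal.toReal_mono hω.ne (ENNReal.le_tsum i)
  simpa [ENNReal.toReal_mul, ENNReal.toReal_pow] using h1

/-- A case of the Kolmogorov-Chentsov theorem, for a process already known to have continuous paths.
The moment bound allows any exponent below `1 / 4`. -/
theorem ae_exists_holderOnWith_of_fourth_moment {Ω : Type*} [MeasurableSpace Ω] {P : Measure Ω}
    {Y : ℝ → Ω → ℝ} (hmeas : ∀ t ∈ Icc (0 : ℝ) 1, AEMeasurable (Y t) P)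
    (hcont : ∀ᵐ ω ∂P, ContinuousOn (fun t => Y t ω) (Icc 0 1)) {M : ℝ≥0∞} (hM : M ≠ ∞)
    (h4 : ∀ s ∈ Icc (0 : ℝ) 1, ∀ t ∈ Icc (0 : ℝ) 1,
      ∫⁻ ω, ‖Y t ω - Y s ω‖ₑ ^ 4 ∂P ≤ M * ‖t - s‖ₑ ^ 2) :
    ∀ᵐ ω ∂P, ∃ K : ℝ≥0, HolderOnWith K (1 / 8) (fun t => Y t ω) (Icc 0 1) := by
  set X : (Σ n : ℕ, Fin (2 ^ n)) → Ω → ℝ :=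
    fun i ω => Y ((i.2 + 1) / 2 ^ i.1) ω - Y (i.2 / 2 ^ i.1) ω with hX
  have hmem : ∀ n k : ℕ, k ≤ 2 ^ n → (k : ℝ) / 2 ^ n ∈ Icc (0 : ℝ) 1 := fun n k hk => by
    refine ⟨by positivity, ?_⟩
    rw [div_le_one (by positivity)]
    exact_mod_cast hk
  have hmem' : ∀ n k : ℕ, k < 2 ^ n → ((k : ℝ) + 1) / 2 ^ n ∈ Icc (0 : ℝ) 1 := fun n k hk => by
    have := hmem n (k + 1) hk
    rwa [Nat.cast_succ] at this
  have hXm : ∀ i, AEMeasurable (X i) P := fun i =>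
    (hmeas _ (hmem' i.1 i.2 i.2.2)).sub (hmeas _ (hmem i.1 i.2 i.2.2.le))
  have hX4 : ∀ i : Σ n : ℕ, Fin (2 ^ n), ∫⁻ ω, ‖X i ω‖ₑ ^ 4 ∂P ≤ M * ((1 / 4 : ℝ≥0) : ℝ≥0∞) ^ i.1 := by
    intro i
    refine (h4 _ (hmem i.1 i.2 i.2.2.le) _ (hmem' i.1 i.2 i.2.2)).trans_eq ?_
    congr 1
    rw [← sub_div, add_sub_cancel_left, ← enorm_pow, Real.enorm_eq_ofReal (by positivity),
      ← ENNReal.coe_pow, ← ENNReal.ofReal_coe_nnreal]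
    congr 1
    push_cast
    rw [div_pow, div_pow, ← pow_mul, mul_comm, pow_mul]
    norm_num
  -- At level `n` the `2 ^ n` increments have fourth moments of order `4 ^ (-n)`, so that the weight
  -- `√2 ^ n` leaves a geometric series of ratio `√2 / 2`.
  have hsqrt : NNReal.sqrt 2 / 2 < 1 := by
    rw [div_lt_one (by norm_num), ← NNReal.coe_lt_coe]
    push_cast
    rw [Real.sqrt_lt' (by norm_num)]
    norm_num
  have hsum : ∑' i : (Σ n : ℕ, Fin (2 ^ n)),
      ((NNReal.sqrt 2 ^ i.1 : ℝ≥0) : ℝ≥0∞) * ∫⁻ ω, ‖X i ω‖ₑ ^ 4 ∂P ≠ ∞ := by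
    rw [ENNReal.tsum_sigma']
    have hle : ∀ n : ℕ, ∑' k : Fin (2 ^ n),
        ((NNReal.sqrt 2 ^ n : ℝ≥0) : ℝ≥0∞) * ∫⁻ ω, ‖X ⟨n, k⟩ ω‖ₑ ^ 4 ∂P
          ≤ M * ((NNReal.sqrt 2 / 2 : ℝ≥0) : ℝ≥0∞) ^ n := by
      intro n
      rw [tsum_fintype]
      refine (Finset.sum_le_card_nsmul _ _
        (((NNReal.sqrt 2 ^ n : ℝ≥0) : ℝ≥0∞) * (M * ((1 / 4 : ℝ≥0) : ℝ≥0∞) ^ n))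
        fun k _ => mul_le_mul_right (hX4 ⟨n, k⟩) _).trans_eq ?_
      have hcalc : (2 : ℝ≥0) ^ n * (NNReal.sqrt 2 ^ n * (1 / 4) ^ n) = (NNReal.sqrt 2 / 2) ^ n := by
        rw [← mul_pow, ← mul_pow]
        congr 1
        rw [← NNReal.coe_inj]
        push_cast
        ring
      rw [Finset.card_univ, Fintype.card_fin, nsmul_eq_mul, ← ENNReal.coe_pow (NNReal.sqrt 2 / 2),
        ← hcalc]
      push_cast
      ring
    refine ((ENNReal.tsum_le_tsum hle).trans_lt ?_).ne
    rw [ENNReal.tsum_mul_left]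
    refine ENNReal.mul_lt_top hM.lt_top ?_
    rw [ENNReal.tsum_geometric, ENNReal.inv_lt_top, tsub_pos_iff_lt]
    exact_mod_cast hsqrt
  filter_upwards [hcont, ae_exists_abs_le_of_tsum_lintegral hXm hsum] with ω hω ⟨C, hC0, hC⟩
  refine exists_holderOnWith_of_dyadic_increments (C := 1 + C) hω (by norm_num) (by positivity)
    fun n k hk => ?_
  -- the exponent `1 / 8` is the one matching the weight `√2 ^ n`: `√2 * ρ ^ 4 = 1`
  set ρ : ℝ := (1 / 2 : ℝ) ^ ((1 / 8 : ℝ≥0) : ℝ) with hρ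
  have hρ4 : √2 * ρ ^ 4 = 1 := by
    rw [hρ, ← Real.rpow_mul_natCast (by norm_num), Real.sqrt_eq_rpow, one_div,
      Real.inv_rpow (by norm_num)]
    norm_num
  have hXk : √2 ^ n * |Y ((k + 1) / 2 ^ n) ω - Y (k / 2 ^ n) ω| ^ 4 ≤ C := by
    simpa [hX] using hC ⟨n, ⟨k, hk⟩⟩
  refine le_of_pow_le_pow_left₀ (n := 4) (by norm_num) (by positivity) ?_
  have hpos : 0 < √2 ^ n := by positivity
  refine le_of_mul_le_mul_left (hXk.trans ?_) hpos
  have : √2 ^ n * ((1 + C) * ρ ^ n) ^ 4 = (1 + C) ^ 4 := by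
    calc √2 ^ n * ((1 + C) * ρ ^ n) ^ 4 = (1 + C) ^ 4 * (√2 * ρ ^ 4) ^ n := by ring
      _ = (1 + C) ^ 4 := by rw [hρ4, one_pow, mul_one]
  rw [this]
  have h1 : 1 + C ≤ (1 + C) ^ 4 := le_self_pow₀ (by linarith) (by norm_num)
  linarith

/-! ### The Brownian bridge -/

namespace IsBrownianBridge

variable {Ω : Type*} [MeasurableSpace Ω] {P : Measure Ω} {W : ℝ → Ω → ℝ} {c : ℝ}

theorem aemeasurable (hW : IsBrownianBridge W c P) {t : ℝ} (ht : t ∈ Icc (0 : ℝ) (2 * π)) :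
    AEMeasurable (W t) P :=
  hW.isGaussianProcess.aemeasurable ⟨t, ht⟩

theorem memLp_two (hW : IsBrownianBridge W c P) {t : ℝ} (ht : t ∈ Icc (0 : ℝ) (2 * π)) :
    MemLp (W t) 2 P :=
  (hW.isGaussianProcess.hasGaussianLaw_eval ⟨t, ht⟩).memLp_two

theorem map_eq_gaussianReal (hW : IsBrownianBridge W c P) {t : ℝ}
    (ht : t ∈ Icc (0 : ℝ) (2 * π)) :
    P.map (W t) = gaussianReal 0 (c * (t - t * t / (2 * π))).toNNReal := by
  rw [(hW.isGaussianProcess.hasGaussianLaw_eval ⟨t, ht⟩).map_eq_gaussianReal,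
    hW.mean_zero t ht, ← covariance_self (hW.aemeasurable ht), hW.covariance_eq t ht t ht, min_self]

theorem map_sub_eq_gaussianReal (hW : IsBrownianBridge W c P) {s t : ℝ}
    (hs : s ∈ Icc (0 : ℝ) (2 * π)) (ht : t ∈ Icc (0 : ℝ) (2 * π)) :
    P.map (fun ω => W t ω - W s ω)
      = gaussianReal 0 (c * (|t - s| - (t - s) ^ 2 / (2 * π))).toNNReal := by
  have := hW.isGaussianProcess.isProbabilityMeasure
  have hlaw : HasGaussianLaw (W t - W s) P :=
    hW.isGaussianProcess.hasGaussianLaw_sub (s := ⟨t, ht⟩) (t := ⟨s, hs⟩)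
  have hmean : ∫ ω, (W t - W s) ω ∂P = 0 := by
    simp only [Pi.sub_apply]
    rw [integral_sub ((hW.memLp_two ht).integrable one_le_two)
      ((hW.memLp_two hs).integrable one_le_two), hW.mean_zero t ht, hW.mean_zero s hs, sub_zero]
  change P.map (W t - W s) = _
  rw [hlaw.map_eq_gaussianReal, hmean, ← covariance_self hlaw.aemeasurable,
    covariance_sub_sub (hW.memLp_two ht) (hW.memLp_two hs) (hW.memLp_two ht) (hW.memLp_two hs),
    hW.covariance_eq t ht t ht, hW.covariance_eq t ht s hs, hW.covariance_eq s hs t ht,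
    hW.covariance_eq s hs s hs]
  congr 2
  rcases le_total s t with h | h
  · rw [min_self, min_self, min_eq_right h, min_eq_left h, abs_of_nonneg (sub_nonneg.2 h)]
    ring
  · rw [min_self, min_self, min_eq_left h, min_eq_right h, abs_of_nonpos (sub_nonpos.2 h)]
    ring

theorem ae_eq_zero_of_variance_eq_zero (hW : IsBrownianBridge W c P) {t : ℝ}
    (ht : t ∈ Icc (0 : ℝ) (2 * π)) (hvar : t - t * t / (2 * π) = 0) : ∀ᵐ ω ∂P, W t ω = 0 := by
  refine ae_of_ae_map (p := fun x => x = 0) (hW.aemeasurable ht) ?_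
  rw [hW.map_eq_gaussianReal ht, hvar, mul_zero, Real.toNNReal_zero, gaussianReal_zero_var,
    ae_dirac_eq]
  simp

theorem ae_apply_zero (hW : IsBrownianBridge W c P) : ∀ᵐ ω ∂P, W 0 ω = 0 :=
  hW.ae_eq_zero_of_variance_eq_zero ⟨le_rfl, by positivity⟩ (by simp)

theorem ae_apply_two_pi (hW : IsBrownianBridge W c P) : ∀ᵐ ω ∂P, W (2 * π) ω = 0 :=
  hW.ae_eq_zero_of_variance_eq_zero ⟨by positivity, le_rfl⟩ (by field_simp; ring)

theorem ae_apply_pi_ne_zero (hW : IsBrownianBridge W c P) (hc : 0 < c) :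
    ∀ᵐ ω ∂P, W π ω ≠ 0 := by
  have hπ : π ∈ Icc (0 : ℝ) (2 * π) := ⟨by positivity, by linarith [Real.pi_pos]⟩
  have hv : (c * (π - π * π / (2 * π))).toNNReal ≠ 0 := by
    have : c * (π - π * π / (2 * π)) = c * π / 2 := by
      field_simp
      ring
    rw [this, Ne, Real.toNNReal_eq_zero, not_le]
    positivity
  refine ae_of_ae_map (p := fun x => x ≠ 0) (hW.aemeasurable hπ) ?_
  have := nullSingletonClass_gaussianReal (μ := 0) hv
  rw [hW.map_eq_gaussianReal hπ]
  exact Measure.ae_ne _ 0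

theorem lintegral_enorm_sub_pow_four_le (hW : IsBrownianBridge W c P) (hc : 0 < c) {s t : ℝ}
    (hs : s ∈ Icc (0 : ℝ) (2 * π)) (ht : t ∈ Icc (0 : ℝ) (2 * π)) :
    ∫⁻ ω, ‖W t ω - W s ω‖ₑ ^ 4 ∂P
      ≤ (‖c‖ₑ ^ 2 * ∫⁻ x, ‖x‖ₑ ^ 4 ∂gaussianReal 0 1) * ‖t - s‖ₑ ^ 2 := by
  rw [← lintegral_map' (f := fun x : ℝ => ‖x‖ₑ ^ 4) (g := fun ω => W t ω - W s ω) (by fun_prop)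
    ((hW.aemeasurable ht).sub (hW.aemeasurable hs)), hW.map_sub_eq_gaussianReal hs ht,
    lintegral_enorm_pow_four_gaussianReal,
    mul_right_comm, ← mul_pow, ← enorm_mul]
  gcongr
  rw [← ofReal_norm, Real.norm_eq_abs, abs_mul, abs_of_pos hc]
  refine ENNReal.ofReal_le_ofReal (mul_le_mul_of_nonneg_left ?_ hc.le)
  have : 0 ≤ (t - s) ^ 2 / (2 * π) := by positivity
  linarith

theorem ae_exists_holderOnWith (hW : IsBrownianBridge W c P) (hc : 0 < c) :
    ∀ᵐ ω ∂P, ∃ K : ℝ≥0, HolderOnWith K (1 / 8) (fun t => W t ω) (Icc 0 (2 * π)) := by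
  have hpi := Real.two_pi_pos
  have hmaps : MapsTo (fun u : ℝ => 2 * π * u) (Icc 0 1) (Icc 0 (2 * π)) := fun u hu =>
    ⟨mul_nonneg hpi.le hu.1, mul_le_of_le_one_right hpi.le hu.2⟩
  have hmaps' : MapsTo (fun t : ℝ => (2 * π)⁻¹ * t) (Icc 0 (2 * π)) (Icc 0 1) := fun t ht =>
    ⟨mul_nonneg (inv_nonneg.2 hpi.le) ht.1, by
      rw [inv_mul_le_iff₀ hpi, mul_one]
      exact ht.2⟩
  set K₄ : ℝ≥0∞ := ∫⁻ x, ‖x‖ₑ ^ 4 ∂gaussianReal 0 1 with hK₄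
  -- rescale time to the unit interval
  have hunit : ∀ᵐ ω ∂P, ∃ K : ℝ≥0,
      HolderOnWith K (1 / 8) (fun u => W (2 * π * u) ω) (Icc 0 1) := by
    refine ae_exists_holderOnWith_of_fourth_moment (M := ‖c‖ₑ ^ 2 * K₄ * ‖2 * π‖ₑ ^ 2)
      (fun u hu => hW.aemeasurable (hmaps hu)) ?_ ?_ fun s hs t ht => ?_
    · filter_upwards [hW.continuousOn_paths] with ω hω
      exact hω.comp (by fun_prop) hmaps
    · exact ENNReal.mul_ne_top (ENNReal.mul_ne_top (ENNReal.pow_ne_top enorm_ne_top)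
        lintegral_enorm_pow_four_gaussianReal_ne_top) (ENNReal.pow_ne_top enorm_ne_top)
    · refine (hW.lintegral_enorm_sub_pow_four_le hc (hmaps hs) (hmaps ht)).trans_eq ?_
      rw [mul_assoc _ (‖2 * π‖ₑ ^ 2), ← mul_pow, ← enorm_mul, mul_sub]
  filter_upwards [hunit] with ω ⟨K, hK⟩
  have hlip : LipschitzWith ‖(2 * π)⁻¹‖₊ (fun t : ℝ => (2 * π)⁻¹ * t) := lipschitzWith_smul _
  have hcomp := hK.comp (holderOnWith_one.2 hlip.lipschitzOnWith) hmaps'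
  rw [mul_one] at hcomp
  refine ⟨K * ‖(2 * π)⁻¹‖₊ ^ ((1 / 8 : ℝ≥0) : ℝ), fun s hs t ht => ?_⟩
  have hst := hcomp s hs t ht
  simp only [Function.comp_apply, mul_inv_cancel_left₀ hpi.ne'] at hst
  exact hst

end IsBrownianBridge

/-! ### Periodic extension -/

theorem HolderOnWith.exists_periodic_extension {w : ℝ → ℝ} {T : ℝ} (hT : 0 < T) {K α : ℝ≥0}
    (hw : HolderOnWith K α w (Icc 0 T)) (h0 : w 0 = w T) :
    ∃ g : ℝ → ℝ, Function.Periodic g T ∧ HolderWith (2 * K) α g ∧ EqOn g w (Icc 0 T) := by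
  refine ⟨fun x => w (toIcoMod hT 0 x), fun x => by simp, ?_, fun x hx => ?_⟩
  · rw [← holderOnWith_univ]
    refine HolderOnWith.of_dist_le fun x _ y _ => ?_
    wlog hxy : x ≤ y generalizing x y
    · rw [dist_comm, dist_comm x]
      exact this y (mem_univ _) x (mem_univ _) (le_of_not_ge hxy)
    have hx := toIcoMod_mem_Ico hT 0 x
    have hy := toIcoMod_mem_Ico hT 0 y
    have hx' := toIcoMod_add_toIcoDiv_zsmul hT 0 x
    have hy' := toIcoMod_add_toIcoDiv_zsmul hT 0 y
    rw [zero_add] at hx hy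
    set x₀ := toIcoMod hT 0 x
    set y₀ := toIcoMod hT 0 y
    set m := toIcoDiv hT 0 x
    set n := toIcoDiv hT 0 y
    rw [zsmul_eq_mul] at hx' hy'
    have hK : (0 : ℝ) ≤ K := K.2
    have hα : (0 : ℝ) ≤ α := α.2
    have hsplit : ((2 * K : ℝ≥0) : ℝ) * dist x y ^ (α : ℝ)
        = K * dist x y ^ (α : ℝ) + K * dist x y ^ (α : ℝ) := by
      push_cast
      ring
    have hmono : ∀ {a b : ℝ}, dist a b ≤ dist x y →
        K * dist a b ^ (α : ℝ) ≤ K * dist x y ^ (α : ℝ) := fun hab =>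
      mul_le_mul_of_nonneg_left (Real.rpow_le_rpow dist_nonneg hab hα) hK
    have hd : dist x y = y - x := by rw [dist_comm, Real.dist_eq, abs_of_nonneg (sub_nonneg.2 hxy)]
    have hxm : x₀ ∈ Icc 0 T := Ico_subset_Icc_self hx
    have hym : y₀ ∈ Icc 0 T := Ico_subset_Icc_self hy
    have hdist_nonneg : 0 ≤ K * dist x y ^ (α : ℝ) := by positivity
    rw [hsplit]
    rcases lt_trichotomy m n with hmn | hmn | hmn
    · -- `x` and `y` are separated by a multiple of `T`, at which the extension is `w 0 = w T`
      have hmn' : (m : ℝ) + 1 ≤ n := by exact_mod_cast hmn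
      have hmT : ((m : ℝ) + 1) * T ≤ n * T := mul_le_mul_of_nonneg_right hmn' hT.le
      have h1 := hw.dist_le hxm (right_mem_Icc.2 hT.le)
      have h2 := hw.dist_le (left_mem_Icc.2 hT.le) hym
      have h3 : dist x₀ T ≤ dist x y := by
        rw [hd, dist_comm, Real.dist_eq, abs_of_nonneg (by linarith [hxm.2])]
        linarith [hym.1]
      have h4 : dist 0 y₀ ≤ dist x y := by
        rw [hd, dist_comm, Real.dist_eq, sub_zero, abs_of_nonneg hym.1]
        linarith [hxm.2]
      calc dist (w x₀) (w y₀) ≤ dist (w x₀) (w T) + dist (w T) (w y₀) := dist_triangle _ _ _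
        _ ≤ _ := add_le_add (h1.trans (hmono h3)) (h0 ▸ h2.trans (hmono h4))
    · have h1 := hw.dist_le hxm hym
      have h3 : dist x₀ y₀ ≤ dist x y := by
        rw [← hx', ← hy', hmn, dist_add_right]
      exact (h1.trans (hmono h3)).trans (le_add_of_nonneg_left hdist_nonneg)
    · have hmn' : (n : ℝ) + 1 ≤ m := by exact_mod_cast hmn
      have hmT : ((n : ℝ) + 1) * T ≤ m * T := mul_le_mul_of_nonneg_right hmn' hT.le
      linarith [hx.1, hy.2]
  · rcases hx.2.lt_or_eq with h | h
    · simp only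
      rw [(toIcoMod_eq_self hT).2 ⟨hx.1, by simpa using h⟩]
    · subst h
      have : toIcoMod hT 0 x = 0 := by simpa using toIcoMod_add_right hT 0 0
      simp only
      rw [this, h0]

/-! ### The kernel `cot (θ / 2)` -/

/-- The kernel `sin θ / (1 - cos θ) = cot (θ / 2)` of the periodic Hilbert transform. It takes the
value `0` at the multiples of `2 π`, where the denominator vanishes. -/
noncomputable def hilbertKernel (θ : ℝ) : ℝ :=
  Real.sin θ / (1 - Real.cos θ)

theorem measurable_hilbertKernel : Measurable hilbertKernel := by
  unfold hilbertKernel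
  fun_prop

theorem one_sub_cos_eq (θ : ℝ) : 1 - Real.cos θ = 2 * Real.sin (θ / 2) ^ 2 := by
  rw [Real.sin_sq_eq_half_sub, mul_div_cancel₀ θ two_ne_zero]
  ring

theorem sin_half_pos {θ : ℝ} (hθ : θ ∈ Ioo 0 (2 * π)) : 0 < Real.sin (θ / 2) :=
  Real.sin_pos_of_pos_of_lt_pi (by linarith [hθ.1]) (by linarith [hθ.2])

theorem one_sub_cos_pos {θ : ℝ} (hθ : θ ∈ Ioo 0 (2 * π)) : 0 < 1 - Real.cos θ := by
  rw [one_sub_cos_eq]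
  exact mul_pos two_pos (pow_pos (sin_half_pos hθ) 2)

theorem mul_cos_le_sin {x : ℝ} (h0 : 0 ≤ x) (hπ : x ≤ π) : x * Real.cos x ≤ Real.sin x := by
  rcases lt_or_ge x (π / 2) with h | h
  · have hc : 0 < Real.cos x := Real.cos_pos_of_mem_Ioo ⟨by linarith [Real.pi_pos], h⟩
    have := Real.le_tan h0 h
    rwa [Real.tan_eq_sin_div_cos, le_div_iff₀ hc] at this
  · exact (mul_nonpos_of_nonneg_of_nonpos h0 (Real.cos_nonpos_of_pi_div_two_le_of_le h
      (by linarith [Real.pi_pos]))).trans (Real.sin_nonneg_of_nonneg_of_le_pi h0 hπ)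

theorem hilbertKernel_eq {θ : ℝ} (hθ : θ ∈ Ioo 0 (2 * π)) :
    hilbertKernel θ = Real.cos (θ / 2) / Real.sin (θ / 2) := by
  have hs := sin_half_pos hθ
  rw [hilbertKernel, div_eq_div_iff (one_sub_cos_pos hθ).ne' hs.ne']
  have h1 : Real.sin θ = 2 * Real.sin (θ / 2) * Real.cos (θ / 2) := by
    rw [← Real.sin_two_mul]; ring_nf
  rw [h1, one_sub_cos_eq]
  ring

theorem abs_hilbertKernel_le {θ : ℝ} (hθ : θ ∈ Ioo 0 (2 * π)) :
    |hilbertKernel θ| ≤ 2 / θ + 2 / (2 * π - θ) := by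
  have hs := sin_half_pos hθ
  have hpos : 0 < θ := hθ.1
  have hpos' : 0 < 2 * π - θ := sub_pos.2 hθ.2
  have h1 : Real.cos (θ / 2) / Real.sin (θ / 2) ≤ 2 / θ := by
    rw [div_le_div_iff₀ hs hpos]
    linarith [mul_cos_le_sin (x := θ / 2) (by linarith) (by linarith)]
  have h2 : -(Real.cos (θ / 2) / Real.sin (θ / 2)) ≤ 2 / (2 * π - θ) := by
    rw [← neg_div, div_le_div_iff₀ hs hpos']
    have := mul_cos_le_sin (x := π - θ / 2) (by linarith) (by linarith)
    rw [Real.cos_pi_sub, Real.sin_pi_sub] at this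
    linarith
  rw [hilbertKernel_eq hθ, abs_le]
  constructor
  · linarith [div_pos two_pos hpos]
  · linarith [div_pos two_pos hpos']

/-! ### The Hilbert transform of a periodic Hölder function -/

section HolderBound

variable {E : Type*} [NormedAddCommGroup E] [NormedSpace ℝ E] {g : ℝ → E} {K α : ℝ≥0}

/-- Near `0` the Hölder bound is used between `φ` and `φ + θ`, near `2 π` between `φ + θ` and
`φ + 2 π`. The bound does not depend on `φ`. -/
theorem norm_hilbertKernel_smul_sub_le (hg : HolderWith K α g)
    (hper : Function.Periodic g (2 * π)) (φ : ℝ) {θ : ℝ} (hθ : θ ∈ Ioc 0 (2 * π)) :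
    ‖hilbertKernel θ • (g (φ + θ) - g φ)‖
      ≤ 2 * K * (θ ^ ((α : ℝ) - 1) + (2 * π - θ) ^ ((α : ℝ) - 1)) := by
  have hK : (0 : ℝ) ≤ K := K.2
  rcases hθ.2.eq_or_lt with rfl | hlt
  · -- the kernel vanishes at `2 π` because `sin (2 π) = 0`
    have : 0 ≤ 2 * π - 2 * π := by simp
    rw [hilbertKernel, Real.sin_two_pi, zero_div, zero_smul, norm_zero]
    positivity
  have hpos : 0 < θ := hθ.1
  have hpos' : 0 < 2 * π - θ := sub_pos.2 hlt
  have h1 : ‖g (φ + θ) - g φ‖ ≤ K * θ ^ (α : ℝ) := by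
    have := hg.dist_le (φ + θ) φ
    rwa [dist_eq_norm, Real.dist_eq, add_sub_cancel_left, abs_of_pos hpos] at this
  have h2 : ‖g (φ + θ) - g φ‖ ≤ K * (2 * π - θ) ^ (α : ℝ) := by
    have := hg.dist_le (φ + θ) (φ + 2 * π)
    rwa [hper φ, dist_eq_norm, Real.dist_eq, add_sub_add_left_eq_sub, abs_sub_comm,
      abs_of_pos hpos'] at this
  rw [norm_smul, Real.norm_eq_abs, Real.rpow_sub_one hpos.ne', Real.rpow_sub_one hpos'.ne']
  calc |hilbertKernel θ| * ‖g (φ + θ) - g φ‖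
      ≤ (2 / θ + 2 / (2 * π - θ)) * ‖g (φ + θ) - g φ‖ := by
        gcongr
        exact abs_hilbertKernel_le ⟨hpos, hlt⟩
    _ = 2 / θ * ‖g (φ + θ) - g φ‖ + 2 / (2 * π - θ) * ‖g (φ + θ) - g φ‖ := add_mul _ _ _
    _ ≤ 2 / θ * (K * θ ^ (α : ℝ)) + 2 / (2 * π - θ) * (K * (2 * π - θ) ^ (α : ℝ)) := by gcongr
    _ = _ := by ring

theorem intervalIntegrable_hilbertBound (hα : 0 < α) (K : ℝ≥0) :
    IntervalIntegrable
      (fun θ : ℝ => 2 * K * (θ ^ ((α : ℝ) - 1) + (2 * π - θ) ^ ((α : ℝ) - 1)))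
      volume 0 (2 * π) := by
  have h : (-1 : ℝ) < (α : ℝ) - 1 := by
    have : (0 : ℝ) < α := hα
    linarith
  refine ((intervalIntegral.intervalIntegrable_rpow' h).add ?_).const_mul _
  have := (intervalIntegral.intervalIntegrable_rpow' (a := 0) (b := 2 * π) h).comp_sub_left (2 * π)
  simpa using this.symm

theorem intervalIntegrable_hilbertKernel_smul_sub (hα : 0 < α) (hg : HolderWith K α g)
    (hper : Function.Periodic g (2 * π)) (φ : ℝ) :
    IntervalIntegrable (fun θ => hilbertKernel θ • (g (φ + θ) - g φ)) volume 0 (2 * π) := by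
  have hcont := hg.continuous hα
  refine (intervalIntegrable_hilbertBound hα K).mono_fun' ?_ ?_
  · exact (measurable_hilbertKernel.aestronglyMeasurable).smul
      (Continuous.aestronglyMeasurable (by fun_prop))
  · rw [uIoc_of_le Real.two_pi_pos.le]
    filter_upwards [ae_restrict_mem measurableSet_Ioc] with θ hθ
    exact norm_hilbertKernel_smul_sub_le hg hper φ hθ

/-- The periodic Hilbert transform `φ ↦ ∫₀^{2π} (g (φ + θ) - g φ) cot (θ / 2) dθ`, without the usual
normalizing constant. Subtracting `g φ` replaces the principal value, the kernel being odd about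
`π`. -/
noncomputable def circleHilbert (g : ℝ → E) (φ : ℝ) : E :=
  ∫ θ in (0 : ℝ)..(2 * π), hilbertKernel θ • (g (φ + θ) - g φ)

theorem continuous_circleHilbert (hα : 0 < α) (hg : HolderWith K α g)
    (hper : Function.Periodic g (2 * π)) : Continuous (circleHilbert g) := by
  have hcont := hg.continuous hα
  refine intervalIntegral.continuous_of_dominated_interval
    (fun φ => ?_) (fun φ => ?_) (intervalIntegrable_hilbertBound hα K) ?_
  · exact (measurable_hilbertKernel.aestronglyMeasurable).smul
      (Continuous.aestronglyMeasurable (by fun_prop))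
  · rw [uIoc_of_le Real.two_pi_pos.le]
    exact Eventually.of_forall fun θ hθ => norm_hilbertKernel_smul_sub_le hg hper φ hθ
  · exact Eventually.of_forall fun θ _ => by fun_prop

end HolderBound

/-! ### The Hilbert transform as a Fourier multiplier -/

section Fourier

theorem fourier_two_pi_apply (n : ℤ) (x : ℝ) :
    fourier n (x : AddCircle (2 * π)) = Complex.exp (n * x * Complex.I) := by
  rw [fourier_coe_apply]
  congr 1
  push_cast
  field_simp

theorem continuous_fourier_coe (n : ℤ) :
    Continuous fun x : ℝ => fourier n (x : AddCircle (2 * π)) :=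
  (fourier n).continuous.comp (AddCircle.continuous_mk' _)

theorem periodic_fourier_coe (n : ℤ) :
    Function.Periodic (fun x : ℝ => fourier n (x : AddCircle (2 * π))) (2 * π) := fun x => by
  simp only [AddCircle.coe_add_period]

theorem integral_fourier_mul_sub {g : ℝ → ℂ} (hg : Continuous g)
    (hper : Function.Periodic g (2 * π)) (n : ℤ) (θ : ℝ) :
    ∫ φ in (0 : ℝ)..(2 * π), fourier (-n) (φ : AddCircle (2 * π)) * (g (φ + θ) - g φ)
      = (fourier n (θ : AddCircle (2 * π)) - 1) *
        ∫ φ in (0 : ℝ)..(2 * π), fourier (-n) (φ : AddCircle (2 * π)) * g φ := by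
  set F : ℝ → ℂ := fun φ => fourier (-n) (φ : AddCircle (2 * π)) * g φ with hF
  have hFc : Continuous F := (continuous_fourier_coe (-n)).mul hg
  have hFp : Function.Periodic F (2 * π) := (periodic_fourier_coe (-n)).mul hper
  have hmul : ∀ φ : ℝ, fourier (-n) (φ : AddCircle (2 * π)) * (g (φ + θ) - g φ)
      = fourier n (θ : AddCircle (2 * π)) * F (φ + θ) - F φ := by
    intro φ
    have : fourier n (θ : AddCircle (2 * π)) * fourier (-n) ((φ + θ : ℝ) : AddCircle (2 * π))
        = fourier (-n) (φ : AddCircle (2 * π)) := by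
      rw [fourier_two_pi_apply, fourier_two_pi_apply, fourier_two_pi_apply, ← Complex.exp_add]
      congr 1
      push_cast
      ring
    rw [hF]
    simp only
    rw [← mul_assoc, this]
    ring
  have hshift : ∫ φ in (0 : ℝ)..(2 * π), F (φ + θ) = ∫ φ in (0 : ℝ)..(2 * π), F φ := by
    rw [intervalIntegral.integral_comp_add_right, zero_add, add_comm (2 * π),
      hFp.intervalIntegral_add_eq θ 0, zero_add]
  simp_rw [hmul]
  rw [intervalIntegral.integral_sub (Continuous.intervalIntegrable (by fun_prop) _ _)
    (hFc.intervalIntegrable _ _), intervalIntegral.integral_const_mul, hshift, sub_one_mul]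

/-- The Hilbert transform is a Fourier multiplier; the symbol at `n` is its value at `0` on the
exponential of frequency `n`. -/
theorem integral_fourier_mul_circleHilbert {g : ℝ → ℂ} {K α : ℝ≥0} (hα : 0 < α)
    (hg : HolderWith K α g) (hper : Function.Periodic g (2 * π)) (n : ℤ) :
    ∫ φ in (0 : ℝ)..(2 * π), fourier (-n) (φ : AddCircle (2 * π)) * circleHilbert g φ
      = circleHilbert (fun x : ℝ => fourier n (x : AddCircle (2 * π))) 0 *
        ∫ φ in (0 : ℝ)..(2 * π), fourier (-n) (φ : AddCircle (2 * π)) * g φ := by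
  have hcont := hg.continuous hα
  have hfour := continuous_fourier_coe (-n)
  have hpi := Real.two_pi_pos.le
  have : IsFiniteMeasure (volume.restrict (uIoc 0 (2 * π))) := by
    rw [uIoc_of_le hpi]
    infer_instance
  have hpull : ∀ φ : ℝ, fourier (-n) (φ : AddCircle (2 * π)) * circleHilbert g φ
      = ∫ θ in (0 : ℝ)..(2 * π), fourier (-n) (φ : AddCircle (2 * π)) *
        hilbertKernel θ • (g (φ + θ) - g φ) := fun φ =>
    (intervalIntegral.integral_const_mul _ _).symm
  simp_rw [hpull]
  rw [intervalIntegral_intervalIntegral_swap, circleHilbert, ← intervalIntegral.integral_mul_const]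
  · refine intervalIntegral.integral_congr fun θ _ => ?_
    simp only [zero_add, QuotientAddGroup.mk_zero, fourier_eval_zero]
    simp_rw [mul_smul_comm]
    rw [intervalIntegral.integral_smul, integral_fourier_mul_sub hcont hper, smul_mul_assoc]
  · have hbound := (intervalIntegrable_iff.1 (intervalIntegrable_hilbertBound hα K)).comp_snd
      (volume.restrict (uIoc 0 (2 * π)))
    rw [IntegrableOn, Measure.volume_eq_prod, ← Measure.prod_restrict]
    refine hbound.mono' ?_ ?_
    · refine AEStronglyMeasurable.mul (Continuous.aestronglyMeasurable (by fun_prop)) ?_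
      exact (measurable_hilbertKernel.comp measurable_snd).aestronglyMeasurable.smul
        (Continuous.aestronglyMeasurable (by fun_prop))
    · rw [Measure.prod_restrict]
      filter_upwards [ae_restrict_mem (measurableSet_uIoc.prod measurableSet_uIoc)] with p hp
      rw [uIoc_of_le hpi] at hp
      rw [Function.uncurry, norm_mul, fourier_apply, Circle.norm_coe, one_mul]
      exact norm_hilbertKernel_smul_sub_le hg hper p.1 hp.2

end Fourier

/-! ### The symbol of the Hilbert transform -/

theorem lipschitzWith_fourier_coe (n : ℤ) :
    LipschitzWith ‖(n : ℝ)‖₊ fun x : ℝ => fourier n (x : AddCircle (2 * π)) := by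
  refine lipschitzWith_of_nnnorm_deriv_le
    (fun x => (hasDerivAt_fourier (2 * π) n x).differentiableAt) fun x => ?_
  rw [(hasDerivAt_fourier (2 * π) n x).deriv, ← NNReal.coe_le_coe]
  push_cast
  rw [norm_mul, fourier_apply, Circle.norm_coe, mul_one]
  have : (2 : ℂ) * π * Complex.I * n / (2 * π) = Complex.I * n := by field_simp
  rw [this]
  simp

theorem intervalIntegrable_hilbertKernel_mul_fourier (n : ℤ) :
    IntervalIntegrable (fun θ => hilbertKernel θ • (fourier n ((0 + θ : ℝ) : AddCircle (2 * π))
      - fourier n ((0 : ℝ) : AddCircle (2 * π)))) volume 0 (2 * π) :=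
  intervalIntegrable_hilbertKernel_smul_sub one_pos (holderWith_one.2 (lipschitzWith_fourier_coe n))
    (periodic_fourier_coe n) 0

theorem im_hilbertKernel_smul_fourier (n : ℤ) (θ : ℝ) :
    (hilbertKernel θ • (fourier n ((0 + θ : ℝ) : AddCircle (2 * π))
      - fourier n ((0 : ℝ) : AddCircle (2 * π)))).im = hilbertKernel θ * Real.sin (n * θ) := by
  rw [fourier_two_pi_apply, fourier_two_pi_apply, zero_add]
  have : (n : ℂ) * (θ : ℂ) * Complex.I = ((n * θ : ℝ) : ℂ) * Complex.I := by push_cast; rfl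
  rw [this, Complex.smul_im, Complex.sub_im, Complex.exp_ofReal_mul_I_im]
  simp

theorem intervalIntegrable_hilbertKernel_mul_sin (n : ℤ) :
    IntervalIntegrable (fun θ => hilbertKernel θ * Real.sin (n * θ)) volume 0 (2 * π) := by
  have h := intervalIntegrable_hilbertKernel_mul_fourier n
  rw [intervalIntegrable_iff] at h ⊢
  have him := h.im
  simp only [RCLike.im_eq_complex_im, im_hilbertKernel_smul_fourier] at him
  exact him

theorem integral_cos_nat_mul {n : ℕ} (hn : n ≠ 0) :
    ∫ θ in (0 : ℝ)..(2 * π), Real.cos (n * θ) = 0 := by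
  have hn' : (n : ℝ) ≠ 0 := by exact_mod_cast hn
  have hsin : Real.sin (n * (2 * π)) = 0 := by
    rw [← mul_assoc]
    exact_mod_cast Real.sin_nat_mul_pi (n * 2)
  rw [intervalIntegral.integral_comp_mul_left _ hn', integral_cos, mul_zero, Real.sin_zero, hsin,
    sub_zero, smul_zero]

/-- The recursion behind the closed form `cot (θ / 2) sin (n θ) = 1 + 2 ∑ cos (j θ) + cos (n θ)`, the
sum being over `0 < j < n`. -/
theorem hilbertKernel_mul_sin_succ {θ : ℝ} (hθ : θ ∈ Ioo 0 (2 * π)) (x : ℝ) :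
    hilbertKernel θ * Real.sin (x + θ)
      = hilbertKernel θ * Real.sin x + (Real.cos (x + θ) + Real.cos x) := by
  have h := (one_sub_cos_pos hθ).ne'
  rw [hilbertKernel, Real.sin_add, Real.cos_add]
  field_simp
  linear_combination Real.cos x * Real.sin_sq_add_cos_sq θ

theorem integral_hilbertKernel_mul_sin_succ (m : ℕ) :
    ∫ θ in (0 : ℝ)..(2 * π), hilbertKernel θ * Real.sin ((m + 1 : ℕ) * θ) = 2 * π := by
  have hsucc : ∀ k : ℕ, ∫ θ in (0 : ℝ)..(2 * π), hilbertKernel θ * Real.sin ((k + 1 : ℕ) * θ)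
      = (∫ θ in (0 : ℝ)..(2 * π), hilbertKernel θ * Real.sin (k * θ))
        + ((∫ θ in (0 : ℝ)..(2 * π), Real.cos ((k + 1 : ℕ) * θ))
          + ∫ θ in (0 : ℝ)..(2 * π), Real.cos (k * θ)) := by
    intro k
    have hcos : ∀ j : ℕ, IntervalIntegrable (fun θ : ℝ => Real.cos (j * θ)) volume 0 (2 * π) :=
      fun j => Continuous.intervalIntegrable (by fun_prop) _ _
    have hk : IntervalIntegrable (fun θ => hilbertKernel θ * Real.sin (k * θ)) volume 0 (2 * π) :=
      by simpa using intervalIntegrable_hilbertKernel_mul_sin k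
    rw [← intervalIntegral.integral_add (hcos _) (hcos _),
      ← intervalIntegral.integral_add hk ((hcos _).add (hcos _))]
    refine intervalIntegral.integral_congr_Ioo_of_le Real.two_pi_pos.le fun θ hθ => ?_
    have := hilbertKernel_mul_sin_succ hθ (k * θ)
    simp only [Nat.cast_succ, add_one_mul]
    exact this
  induction m with
  | zero =>
    rw [hsucc, integral_cos_nat_mul (by norm_num)]
    simp
  | succ m ih =>
    rw [hsucc, ih, integral_cos_nat_mul (by omega), integral_cos_nat_mul (by omega)]
    simp

/-- The imaginary part of the symbol at `n` is `2 π` times the sign of `n`. -/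
theorem circleHilbert_fourier_ne_zero {n : ℤ} (hn : n ≠ 0) :
    circleHilbert (fun x : ℝ => fourier n (x : AddCircle (2 * π))) 0 ≠ 0 := by
  intro h0
  have him := congrArg Complex.im h0
  have hint : ∫ θ in (0 : ℝ)..(2 * π), hilbertKernel θ * Real.sin (n * θ) = 0 := by
    rw [circleHilbert, ← RCLike.im_eq_complex_im,
      ← intervalIntegral.intervalIntegral_im (intervalIntegrable_hilbertKernel_mul_fourier n)] at him
    simpa only [RCLike.im_eq_complex_im, im_hilbertKernel_smul_fourier, Complex.zero_im] using him
  have hpi := Real.two_pi_pos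
  rcases lt_or_gt_of_ne hn with h | h
  · obtain ⟨m, hm⟩ : ∃ m : ℕ, n = -((m + 1 : ℕ) : ℤ) := ⟨(-n - 1).toNat, by omega⟩
    have := integral_hilbertKernel_mul_sin_succ m
    subst hm
    simp only [Int.cast_neg, Int.cast_natCast, neg_mul, Real.sin_neg, mul_neg,
      intervalIntegral.integral_neg] at hint
    linarith
  · obtain ⟨m, hm⟩ : ∃ m : ℕ, n = ((m + 1 : ℕ) : ℤ) := ⟨(n - 1).toNat, by omega⟩
    have := integral_hilbertKernel_mul_sin_succ m
    subst hm
    simp only [Int.cast_natCast] at hint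
    linarith

theorem circleHilbert_ofReal (g : ℝ → ℝ) (φ : ℝ) :
    circleHilbert (fun x => (g x : ℂ)) φ = ((circleHilbert g φ : ℝ) : ℂ) := by
  rw [circleHilbert, circleHilbert, ← intervalIntegral.integral_ofReal]
  refine intervalIntegral.integral_congr fun θ _ => ?_
  simp

/-! ### Mean and kernel of the Hilbert transform -/

section Real

variable {g : ℝ → ℝ} {K α : ℝ≥0}

theorem HolderWith.ofReal_comp (hg : HolderWith K α g) : HolderWith K α fun x => (g x : ℂ) := by
  simpa [Function.comp_def] using
    (holderWith_one.2 Complex.isometry_ofReal.lipschitz).comp hg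

/-- The symbol vanishes at frequency zero. -/
theorem integral_circleHilbert (hα : 0 < α) (hg : HolderWith K α g)
    (hper : Function.Periodic g (2 * π)) : ∫ φ in (0 : ℝ)..(2 * π), circleHilbert g φ = 0 := by
  have hperC : Function.Periodic (fun x => (g x : ℂ)) (2 * π) := hper.comp Complex.ofReal
  have h := integral_fourier_mul_circleHilbert hα hg.ofReal_comp hperC 0
  have h0 : circleHilbert (fun x : ℝ => fourier 0 (x : AddCircle (2 * π))) 0 = 0 := by
    simp [circleHilbert]
  simp_rw [h0, zero_mul, neg_zero, fourier_zero, one_mul, circleHilbert_ofReal] at h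
  rw [intervalIntegral.integral_ofReal] at h
  exact_mod_cast h

/-- Only constants have vanishing Hilbert transform: all other Fourier coefficients are zero, so the
Fourier series is summable and reduces to its constant term. -/
theorem eq_of_circleHilbert_eq_zero (hα : 0 < α) (hg : HolderWith K α g)
    (hper : Function.Periodic g (2 * π)) (h : ∀ φ ∈ Icc 0 (2 * π), circleHilbert g φ = 0)
    (x y : ℝ) : g x = g y := by
  have : Fact (0 < 2 * π) := ⟨Real.two_pi_pos⟩
  have hperC : Function.Periodic (fun x => (g x : ℂ)) (2 * π) := hper.comp Complex.ofReal
  have hcont : Continuous fun x => (g x : ℂ) := hg.ofReal_comp.continuous hα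
  let f : C(AddCircle (2 * π), ℂ) := ⟨hperC.lift, hcont.quotient_liftOn' _⟩
  have hcoeff : ∀ n ≠ 0, fourierCoeff f n = 0 := by
    intro n hn
    have hint := integral_fourier_mul_circleHilbert hα hg.ofReal_comp hperC n
    have hleft : ∫ φ in (0 : ℝ)..(2 * π), fourier (-n) (φ : AddCircle (2 * π)) *
        circleHilbert (fun x => (g x : ℂ)) φ = 0 := by
      refine (intervalIntegral.integral_congr (g := fun _ => (0 : ℂ)) fun φ hφ => ?_).trans
        intervalIntegral.integral_zero
      rw [uIcc_of_le Real.two_pi_pos.le] at hφ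
      simp [circleHilbert_ofReal, h φ hφ]
    rw [hleft, eq_comm, mul_eq_zero, or_iff_right (circleHilbert_fourier_ne_zero hn)] at hint
    rw [fourierCoeff_eq_intervalIntegral f n 0, zero_add]
    exact smul_eq_zero_of_right _ hint
  have hsum : Summable (fourierCoeff f) :=
    summable_of_ne_finset_zero (s := {0}) fun n hn => hcoeff n (by simpa using hn)
  have hconst : ∀ z : AddCircle (2 * π), f z = fourierCoeff f 0 := by
    intro z
    refine (has_pointwise_sum_fourier_series_of_summable hsum z).unique ?_
    have := hasSum_single (f := fun i => fourierCoeff f i • fourier i z) 0 fun n hn => by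
      rw [hcoeff n hn, zero_smul]
    simpa using this
  have hxy : (g x : ℂ) = g y := (hconst x).trans (hconst y).symm
  exact_mod_cast hxy

end Real

/-! ### The shift integral -/

theorem shiftPath_eq_of_eqOn {w g : ℝ → ℝ} (hper : Function.Periodic g (2 * π))
    (hgw : EqOn g w (Icc 0 (2 * π))) {φ θ : ℝ} (hφ : φ ∈ Icc (0 : ℝ) (2 * π))
    (hθ : θ ∈ Icc (0 : ℝ) (2 * π)) : shiftPath w φ θ = g (φ + θ) - g φ := by
  rw [shiftPath, hgw hφ]
  split_ifs with h
  · rw [hgw ⟨add_nonneg hφ.1 hθ.1, by linarith⟩]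
  · rw [← hper.sub_eq, hgw ⟨by linarith, by linarith [hφ.2, hθ.2]⟩]

theorem shiftIntegrand_eq_of_eqOn {w g : ℝ → ℝ} (hper : Function.Periodic g (2 * π))
    (hgw : EqOn g w (Icc 0 (2 * π))) {φ θ : ℝ} (hφ : φ ∈ Icc (0 : ℝ) (2 * π))
    (hθ : θ ∈ Icc (0 : ℝ) (2 * π)) :
    shiftIntegrand w φ θ = hilbertKernel θ • (g (φ + θ) - g φ) := by
  rw [shiftIntegrand, shiftPath_eq_of_eqOn hper hgw hφ hθ, hilbertKernel, smul_eq_mul, mul_comm]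

/-- The deterministic form of the result, for a single nonconstant Hölder continuous loop. -/
theorem shiftIntegral_properties {w : ℝ → ℝ} {K α : ℝ≥0} (hα : 0 < α)
    (hw : HolderOnWith K α w (Icc 0 (2 * π))) (hends : w 0 = w (2 * π)) (hne : w π ≠ w 0) :
    (∀ φ ∈ Icc (0 : ℝ) (2 * π), IntervalIntegrable (shiftIntegrand w φ) volume 0 (2 * π)) ∧
      ContinuousOn (shiftIntegral w) (Icc (0 : ℝ) (2 * π)) ∧
      (∫ φ in (0 : ℝ)..(2 * π), shiftIntegral w φ) = 0 ∧
      0 < shiftIntegralSup w := by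
  have hpi := Real.two_pi_pos
  obtain ⟨g, hper, hg, hgw⟩ := hw.exists_periodic_extension hpi hends
  have hI : EqOn (shiftIntegral w) (circleHilbert g) (Icc 0 (2 * π)) := fun φ hφ =>
    intervalIntegral.integral_congr fun θ hθ => by
      rw [uIcc_of_le hpi.le] at hθ
      exact shiftIntegrand_eq_of_eqOn hper hgw hφ hθ
  have hcont : ContinuousOn (shiftIntegral w) (Icc 0 (2 * π)) :=
    (continuous_circleHilbert hα hg hper).continuousOn.congr hI
  have hzero : (∫ φ in (0 : ℝ)..(2 * π), shiftIntegral w φ) = 0 := by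
    refine Eq.trans ?_ (integral_circleHilbert hα hg hper)
    refine intervalIntegral.integral_congr fun φ hφ => hI ?_
    rwa [uIcc_of_le hpi.le] at hφ
  refine ⟨fun φ hφ => ?_, hcont, hzero, ?_⟩
  · refine (intervalIntegrable_hilbertKernel_smul_sub hα hg hper φ).congr fun θ hθ => ?_
    rw [uIoc_of_le hpi.le] at hθ
    exact (shiftIntegrand_eq_of_eqOn hper hgw hφ (Ioc_subset_Icc_self hθ)).symm
  · by_contra hsup
    rw [not_lt, shiftIntegralSup] at hsup
    have hle : ∀ φ ∈ Icc (0 : ℝ) (2 * π), shiftIntegral w φ ≤ 0 := fun φ hφ =>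
      (le_csSup (isCompact_Icc.image_of_continuousOn hcont).bddAbove
        (mem_image_of_mem _ hφ)).trans hsup
    have hall : ∀ φ ∈ Icc (0 : ℝ) (2 * π), circleHilbert g φ = 0 := by
      intro φ hφ
      rw [← hI hφ]
      by_contra hφ0
      have := intervalIntegral.integral_lt_integral_of_continuousOn_of_le_of_exists_lt hpi hcont
        (continuousOn_const (c := (0 : ℝ))) (fun ψ hψ => hle ψ (Ioc_subset_Icc_self hψ))
        ⟨φ, hφ, lt_of_le_of_ne (hle φ hφ) hφ0⟩
      rw [hzero, intervalIntegral.integral_zero] at this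
      exact this.false
    apply hne
    rw [← hgw ⟨Real.pi_pos.le, by linarith [Real.pi_pos]⟩, ← hgw ⟨le_rfl, hpi.le⟩]
    exact eq_of_circleHilbert_eq_zero hα hg hper hall π 0

theorem mainTheorem6 {Ω : Type*} [MeasurableSpace Ω] (P : Measure Ω) [IsProbabilityMeasure P]
    (W : ℝ → Ω → ℝ) (c : ℝ) (hc : 0 < c) (hW : IsBrownianBridge W c P) :
    ∀ᵐ ω ∂P,
      (∀ φ ∈ Icc (0 : ℝ) (2 * π),
        IntervalIntegrable (shiftIntegrand (fun t => W t ω) φ) volume 0 (2 * π)) ∧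
      ContinuousOn (shiftIntegral (fun t => W t ω)) (Icc (0 : ℝ) (2 * π)) ∧
      (∫ φ in (0 : ℝ)..(2 * π), shiftIntegral (fun t => W t ω) φ) = 0 ∧
      0 < shiftIntegralSup (fun t => W t ω) := by
  filter_upwards [hW.ae_exists_holderOnWith hc, hW.ae_apply_zero, hW.ae_apply_two_pi,
    hW.ae_apply_pi_ne_zero hc] with ω ⟨K, hK⟩ h0 h2π hπ
  exact shiftIntegral_properties (by norm_num) hK (h0.trans h2π.symm) (h0.symm ▸ hπ)
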